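/- Let $K$ be a field and let $t\ge 2$ be an integer. A \emph{run of length} $p\ge 1$ is the simplicial complex $\Delta_t(L_{p+t-1})$ whose vertices are the $p+t-1$ vertices of the line graph $L_{p+t-1}$ and whose facets are the vertex sets of the paths on $t$ distinct vertices in it (there are $p$ facets). If $\Gamma$ is a simplicial complex with finite vertex set $V$ and facets $E_1,\dots,E_m$, its complement is the complex $\Gamma^c=\langle V\setminus E_1,\dots,V\setminus E_m\rangle$ generated by the sets $V\setminus E_k$. For positive integers $s_1,\dots,s_r$ we write $E(s_1,\dots,s_r)=\Gamma^c$ whenever the connected components of $\Gamma$ are $r$ runs, of lengths $s_1,\dots,s_r$; up to isomorphism this depends only on $s_1,\dots,s_r$ and $t$. Reduced homology $\widetilde H_i$, $i\in\mathbb Z$, is simplicial with coefficients in $K$ (so $\widetilde H_{-1}(\{\emptyset\})=K$). Let $s_1,\dots,s_r$ be positive integers, let $\mathcal E=E(s_1,\dots,s_r)$, let $1\le j\le r$, and write $s_j=(t+1)p_j+d_j$ with $p_j\ge 0$ and $0\le d_j\le t$. Then for all $i\in\mathbb Z$: (i) if $s_j\ge t+2$, then $\widetilde H_i(\mathcal E)\cong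 \widetilde H_{i-2}(E(s_1,\dots,s_j-(t+1),\dots,s_r))$; (ii) if $d_j\ne 1,2$, then $\widetilde H_i(\mathcal E)=0$; (iii) if $s_j=2$ and $r\ge 2$, then $\widetilde H_i(\mathcal E)\cong\widetilde H_{i-2}(E(s_1,\dots,s_{j-1},s_{j+1},\dots,s_r))$; (iv) if $s_j=1$ and $r\ge 2$, then $\widetilde H_i(\mathcal E)\cong\widetilde H_{i-1}(E(s_1,\dots,s_{j-1},s_{j+1},\dots,s_r))$. -/

import Mathlib

namespace RunHomology

/-- A collection of finite subsets of `V` (the faces, with `∅` allowed as a face) that is closed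
under passing to subsets.  Singletons are not required to be faces, since complements such as
`{∅}` have to be covered. -/
structure SComplex (V : Type*) where
  faces : Set (Finset V)
  down_closed : ∀ F ∈ faces, ∀ G, G ⊆ F → G ∈ faces

namespace SComplex

variable {V W : Type*}

/-- The complex `⟨F₁, …, F_m⟩` generated by a collection of finite sets. -/
def generate (S : Set (Finset V)) : SComplex V where
  faces := {G | ∃ F ∈ S, G ⊆ F}
  down_closed := by
    rintro F ⟨F', hF', h⟩ G hG
    exact ⟨F', hF', hG.trans h⟩

/-- The facets: faces that are maximal under inclusion. -/
def facets (Δ : SComplex V) : Set (Finset V) := {F | Maximal (fun G => G ∈ Δ.faces) F}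

/-- The complement of `Δ` in its whole vertex set `V`: the complex generated by the sets `V \ F`,
for `F` a facet of `Δ`. -/
def compl [Fintype V] [DecidableEq V] (Δ : SComplex V) : SComplex V :=
  generate ((fun F => Fᶜ) '' Δ.facets)

/-- The faces of `Δ` contained in `S`, as a complex with vertex set `S`. -/
def restrict (Δ : SComplex V) (S : Set V) : SComplex S where
  faces := {F | F.map (Function.Embedding.subtype (· ∈ S)) ∈ Δ.faces}
  down_closed := by
    intro F hF G hG
    exact Δ.down_closed _ hF _ (Finset.map_subset_map.2 hG)

/-- Two complexes are isomorphic: some bijection of the vertex sets identifies their faces. -/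
def Isomorphic (Δ : SComplex V) (Δ' : SComplex W) : Prop :=
  ∃ e : V ≃ W, ∀ F : Finset V, F ∈ Δ.faces ↔ F.map e.toEmbedding ∈ Δ'.faces

/-- The graph of edges (one-dimensional faces) of `Δ`. -/
def edgeGraph [DecidableEq V] (Δ : SComplex V) : SimpleGraph V where
  Adj u v := u ≠ v ∧ ({u, v} : Finset V) ∈ Δ.faces
  symm := ⟨fun u v h => ⟨h.1.symm, by rw [Finset.pair_comm]; exact h.2⟩⟩
  loopless := ⟨fun _ h => h.1 rfl⟩

section Homology

variable (K : Type*) [Field K] [Fintype V] [LinearOrder V]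

/-- The simplicial boundary map on formal `K`-linear combinations of subsets of `V` (written as
their coefficient functions, so that `Pi.single F 1` stands for the oriented simplex `F`):
`F = {v₀ < ⋯ < v_i}` is sent to `∑ₖ (-1)^k (F \ {vₖ})`.  A one-point set is sent to `∅`, so this
is the boundary map of the augmented (reduced) chain complex. -/
def boundary : (Finset V → K) →ₗ[K] (Finset V → K) :=
  Fintype.linearCombination K fun F : Finset V =>
    ∑ v ∈ F, Pi.single (F.erase v) ((-1 : K) ^ (F.filter (· < v)).card)

/-- The reduced `i`-chains of `Δ`: combinations of the faces with `i + 1` vertices. -/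
def chains (Δ : SComplex V) (i : ℤ) : Submodule K (Finset V → K) where
  carrier := {c | ∀ F, c F ≠ 0 → F ∈ Δ.faces ∧ (F.card : ℤ) = i + 1}
  zero_mem' := fun F h => absurd rfl h
  add_mem' := by
    intro a b ha hb F h
    by_cases h0 : a F = 0
    · exact hb F fun h1 => h (by simp [h0, h1])
    · exact ha F h0
  smul_mem' := by
    intro r a ha F h
    exact ha F fun h1 => h (by simp [h1])

/-- The reduced `i`-cycles of `Δ`. -/
def cycles (Δ : SComplex V) (i : ℤ) : Submodule K (Finset V → K) :=
  Δ.chains K i ⊓ LinearMap.ker (boundary K)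

/-- The reduced `i`-boundaries of `Δ`. -/
def boundaries (Δ : SComplex V) (i : ℤ) : Submodule K (Finset V → K) :=
  (Δ.chains K (i + 1)).map (boundary K)

theorem boundary_single (F : Finset V) (a : K) :
    boundary K (Pi.single F a) =
      a • ∑ v ∈ F, Pi.single (F.erase v) ((-1 : K) ^ (F.filter (· < v)).card) := by
  simp [boundary, Fintype.linearCombination_apply_single]

theorem boundary_comp_boundary :
    (boundary K (V := V)).comp (boundary K) = 0 := by
  ext1 F
  ext1
  simp only [LinearMap.comp_apply, LinearMap.single_apply, boundary_single, one_smul, map_sum,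
    LinearMap.zero_apply, Finset.smul_sum, ← Pi.single_smul, smul_eq_mul]
  rw [Finset.sum_sigma']
  refine Finset.sum_involution (fun p _ => ⟨p.2, p.1⟩) ?_ ?_ ?_ ?_
  · rintro ⟨v, w⟩ h
    simp only [Finset.mem_sigma, Finset.mem_erase] at h
    obtain ⟨hv, hwv, hw⟩ := h
    simp only
    rw [Finset.erase_right_comm (a := w) (b := v), ← Pi.single_add]
    have key : ∀ a b : V, a ∈ F → b ∈ F → a < b →
        ((F.erase b).filter (· < a)).card = (F.filter (· < a)).card ∧
        ((F.erase a).filter (· < b)).card + 1 = (F.filter (· < b)).card := by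
      intro a b ha hb hab
      constructor
      · rw [Finset.filter_erase, Finset.erase_eq_of_notMem]
        simp [hab.le]
      · rw [Finset.filter_erase, Finset.card_erase_add_one]
        simp [ha, hab]
    rw [Pi.single_eq_zero_iff]
    rcases lt_or_gt_of_ne hwv with hlt | hlt
    · obtain ⟨h1, h2⟩ := key w v hw hv hlt
      rw [h1, ← h2]; ring
    · obtain ⟨h1, h2⟩ := key v w hv hw hlt
      rw [h1, ← h2]; ring
  · rintro ⟨v, w⟩ h _ heq
    simp only [Finset.mem_sigma, Finset.mem_erase] at h
    simp only [Sigma.mk.injEq, heq_eq_eq] at heq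
    exact h.2.1 heq.1
  · rintro ⟨v, w⟩ h
    simp only [Finset.mem_sigma, Finset.mem_erase] at h ⊢
    exact ⟨h.2.2, h.2.1.symm, h.1⟩
  · rintro ⟨v, w⟩ _
    rfl

/-- Every boundary is a cycle, so that the quotient below is the honest `Z_i / B_i`. -/
theorem boundaries_le_cycles (Δ : SComplex V) (i : ℤ) :
    Δ.boundaries K i ≤ Δ.cycles K i := by
  refine le_inf ?_ ?_
  · rintro _ ⟨c, hc, rfl⟩ G hG
    simp only [boundary, Fintype.linearCombination_apply, Finset.sum_apply, Pi.smul_apply,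
      smul_eq_mul] at hG
    obtain ⟨F, -, hF⟩ := Finset.exists_ne_zero_of_sum_ne_zero hG
    obtain ⟨v, hv, hvG⟩ := Finset.exists_ne_zero_of_sum_ne_zero (right_ne_zero_of_mul hF)
    obtain ⟨h1, h2⟩ := hc F (left_ne_zero_of_mul hF)
    have hGe : G = F.erase v := by
      by_contra h
      exact hvG (Pi.single_eq_of_ne h _)
    subst hGe
    refine ⟨Δ.down_closed F h1 _ (Finset.erase_subset _ _), ?_⟩
    have := Finset.card_erase_add_one hv
    lia
  · rintro _ ⟨x, _, rfl⟩
    exact LinearMap.congr_fun (boundary_comp_boundary K) x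

/-- The `i`-th reduced homology `H̃_i(Δ; K) = Z_i / B_i`. -/
abbrev ReducedHomology (Δ : SComplex V) (i : ℤ) : Type _ :=
  Δ.cycles K i ⧸ (Δ.boundaries K i).submoduleOf (Δ.cycles K i)

end Homology

end SComplex

/-- The path complex `Δ_t(G)`: its facets are the vertex sets of the paths of `G` with `t`
(distinct) vertices, a path being an injective homomorphism from the path graph on `t` vertices. -/
def pathComplex {V : Type*} (t : ℕ) (G : SimpleGraph V) : SComplex V :=
  SComplex.generate {F | ∃ f : SimpleGraph.pathGraph t →g G,
    Function.Injective f ∧ (F : Set V) = Set.range f}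

/-- The run of length `p`: the path complex `Δ_t(L_{p+t-1})` of a line on `p + t - 1` vertices
(used for `1 ≤ p` and `2 ≤ t`). -/
def run (t p : ℕ) : SComplex (Fin (p + t - 1)) :=
  pathComplex t (SimpleGraph.pathGraph (p + t - 1))

/-- The connected components of `Γ` are runs of the lengths `s j`, one for each index `j`. -/
def ComponentsAreRuns {V ι : Type*} [DecidableEq V] (t : ℕ) (Γ : SComplex V) (s : ι → ℕ) : Prop :=
  (∀ j, 1 ≤ s j) ∧
  ∃ c : ι ≃ Γ.edgeGraph.ConnectedComponent,
    ∀ j, (Γ.restrict (c j).supp).Isomorphic (run t (s j))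

end RunHomology

/-! Number the vertices of each line by consecutive naturals. A set is a face of the complement
exactly when it misses some window, i.e. some interval of `t` consecutive points in one line. All
complexes used are of the form `missing φ A H`: subsets of `A` that miss a member of `H`.

Two consequences of Mayer–Vietoris for a union of two cones or otherwise acyclic complexes carry the
proof. If deleting a vertex leaves an acyclic complex, the homology is that of the link, shifted by
one (`nonempty_homology_equiv_link`). If a window is disjoint from all the others, it can be removed
together with its points, again with a shift by one (`nonempty_homology_equiv_of_disjoint`).

Let line `j` have at least two windows from its first point `a` on. Delete the point `a + t` just
after the first window. The second window then lies inside the first and avoids `a`, so the deletion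
is a cone with apex `a`. In the link only windows avoiding `a + t` survive: the first one and those
starting at `a + t + 1` or later. The first is now isolated, and if another window remains it can be
removed. This costs `t + 1` points and two degrees, which gives (i), and (iii) when the line is
thereby used up. For (iv) the only window of the line is isolated from the start. For (ii), repeated
shortening leaves between 3 and `t + 1` windows; then the point `a + t + 1` lies in no window of the
link, which is a cone. -/

namespace RunHomology
namespace SComplex

/-! ### Homological tools: Mayer–Vietoris, cones, relabelling of vertices. -/

section Homology

set_option linter.unusedSectionVars false

variable {K : Type*} [Field K]

/-- A linear map which carries cycles to cycles and identifies the boundaries, and is onto modulo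
boundaries, induces an isomorphism of subquotients. -/
theorem nonempty_subquotient_equiv {M N : Type*} [AddCommGroup M] [Module K M] [AddCommGroup N]
    [Module K N] (Z B : Submodule K M) (Z' B' : Submodule K N) (g : M →ₗ[K] N)
    (hg : ∀ z ∈ Z, g z ∈ Z') (hker : ∀ z ∈ Z, g z ∈ B' ↔ z ∈ B)
    (hsurj : ∀ y ∈ Z', ∃ z ∈ Z, y - g z ∈ B') :
    Nonempty ((Z ⧸ B.submoduleOf Z) ≃ₗ[K] (Z' ⧸ B'.submoduleOf Z')) := by
  let f : Z →ₗ[K] (Z' ⧸ B'.submoduleOf Z') := (B'.submoduleOf Z').mkQ ∘ₗ g.restrict hg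
  have hf : Function.Surjective f := by
    intro y
    obtain ⟨⟨y, hy⟩, rfl⟩ := Submodule.mkQ_surjective _ y
    obtain ⟨z, hz, h⟩ := hsurj y hy
    refine ⟨⟨z, hz⟩, ?_⟩
    refine Eq.symm ((Submodule.Quotient.eq _).2 ?_)
    simpa [Submodule.submoduleOf] using h
  have hk : LinearMap.ker f = B.submoduleOf Z := by
    ext ⟨z, hz⟩
    rw [LinearMap.mem_ker, LinearMap.comp_apply, Submodule.mkQ_apply,
      Submodule.Quotient.mk_eq_zero]
    exact hker z hz
  exact ⟨(Submodule.quotEquivOfEq _ _ hk.symm).trans (f.quotKerEquivOfSurjective hf)⟩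

variable {V : Type*} [Fintype V] [LinearOrder V]

theorem boundary_mem_chains {X : SComplex V} {i : ℤ} {c : Finset V → K}
    (hc : c ∈ X.chains K (i + 1)) : boundary K c ∈ X.chains K i :=
  (X.boundaries_le_cycles K i ⟨c, hc, rfl⟩).1

theorem boundary_boundary (c : Finset V → K) : boundary K (boundary K c) = 0 :=
  LinearMap.congr_fun (boundary_comp_boundary K) c

theorem chains_eq_span (X : SComplex V) (i : ℤ) :
    X.chains K i =
      Submodule.span K {c | ∃ F ∈ X.faces, (F.card : ℤ) = i + 1 ∧ c = Pi.single F (1 : K)} := by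
  classical
  apply le_antisymm
  · intro c hc
    rw [pi_eq_sum_univ' c]
    refine Submodule.sum_mem _ fun F _ => ?_
    by_cases h : c F = 0
    · simp [h]
    · obtain ⟨h1, h2⟩ := hc F h
      refine Submodule.smul_mem _ _ (Submodule.subset_span ⟨F, h1, h2, ?_⟩)
      ext G
      simp [Pi.single_apply, eq_comm]
  · rw [Submodule.span_le]
    rintro _ ⟨F, h1, h2, rfl⟩ G hG
    obtain rfl : G = F := by
      by_contra h
      exact hG (Pi.single_eq_of_ne h _)
    exact ⟨h1, h2⟩

theorem single_mem_chains {X : SComplex V} {i : ℤ} {F : Finset V} (hF : F ∈ X.faces)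
    (hi : (F.card : ℤ) = i + 1) : Pi.single F (1 : K) ∈ X.chains K i := by
  rw [chains_eq_span]
  exact Submodule.subset_span ⟨F, hF, hi, rfl⟩

theorem chains_mono {X Y : SComplex V} (h : X.faces ⊆ Y.faces) (i : ℤ) :
    X.chains K i ≤ Y.chains K i :=
  fun _ hc F hF => ⟨h (hc F hF).1, (hc F hF).2⟩

variable (K) in
/-- Every cycle is a boundary. -/
def IsAcyclic (X : SComplex V) : Prop := ∀ i, X.cycles K i ≤ X.boundaries K i

theorem IsAcyclic.subsingleton {X : SComplex V} (h : X.IsAcyclic K) (i : ℤ) :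
    Subsingleton (ReducedHomology K X i) := by
  rw [Submodule.Quotient.subsingleton_iff]
  ext ⟨z, hz⟩
  simpa [Submodule.submoduleOf] using h i hz

/-- **Mayer–Vietoris** for a union of two acyclic complexes. -/
theorem nonempty_homology_equiv_of_union {X Y₁ Y₂ Y : SComplex V}
    (hX : X.faces = Y₁.faces ∪ Y₂.faces) (hY : Y.faces = Y₁.faces ∩ Y₂.faces)
    (h₁ : Y₁.IsAcyclic K) (h₂ : Y₂.IsAcyclic K) (i : ℤ) :
    Nonempty (ReducedHomology K X (i + 1) ≃ₗ[K] ReducedHomology K Y i) := by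
  classical
  have hYc : ∀ k c, c ∈ Y₁.chains K k → c ∈ Y₂.chains K k → c ∈ Y.chains K k :=
    fun k c a b F hF => ⟨hY ▸ ⟨(a F hF).1, (b F hF).1⟩, (a F hF).2⟩
  have hY₁ : ∀ k, Y.chains K k ≤ Y₁.chains K k := chains_mono (hY ▸ Set.inter_subset_left)
  have hY₂ : ∀ k, Y.chains K k ≤ Y₂.chains K k := chains_mono (hY ▸ Set.inter_subset_right)
  have hX₁ : ∀ k, Y₁.chains K k ≤ X.chains K k := chains_mono (hX ▸ Set.subset_union_left)
  have hX₂ : ∀ k, Y₂.chains K k ≤ X.chains K k := chains_mono (hX ▸ Set.subset_union_right)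
  -- Truncation to the faces of `Y₁` splits a chain `c` of `X` as `ρ c` in `Y₁` plus `c - ρ c` in
  -- `Y₂`. Hence `∂ ∘ ρ` is the connecting homomorphism on the chain level.
  let ρ : (Finset V → K) →ₗ[K] (Finset V → K) :=
    LinearMap.pi fun F => if F ∈ Y₁.faces then LinearMap.proj F else 0
  have hρ : ∀ c F, ρ c F = if F ∈ Y₁.faces then c F else 0 := by
    intro c F
    by_cases h : F ∈ Y₁.faces <;> simp [ρ, h]
  have ρ₁ : ∀ k c, c ∈ X.chains K k → ρ c ∈ Y₁.chains K k := by
    intro k c hc F hF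
    rw [hρ] at hF
    split_ifs at hF with h
    · exact ⟨h, (hc F hF).2⟩
    · exact absurd rfl hF
  have ρ₂ : ∀ k c, c ∈ X.chains K k → c - ρ c ∈ Y₂.chains K k := by
    intro k c hc F hF
    rw [Pi.sub_apply, hρ] at hF
    split_ifs at hF with h
    · simp at hF
    · rw [sub_zero] at hF
      obtain ⟨a, b⟩ := hc F hF
      rw [hX] at a
      exact ⟨a.resolve_left h, b⟩
  have ρ₃ : ∀ k c, c ∈ Y₁.chains K k → ρ c = c := by
    intro k c hc
    ext F
    rw [hρ]
    split_ifs with h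
    · rfl
    · by_contra h'
      exact h (hc F (Ne.symm h')).1
  have ρ₄ : ∀ k c, c ∈ Y₂.chains K k → ρ c ∈ Y₂.chains K k := by
    intro k c hc F hF
    rw [hρ] at hF
    split_ifs at hF with h
    · exact hc F hF
    · exact absurd rfl hF
  refine nonempty_subquotient_equiv _ _ _ _ (boundary K ∘ₗ ρ) ?_ ?_ ?_
  · rintro z ⟨hz, hz0⟩
    refine ⟨hYc _ _ (boundary_mem_chains (ρ₁ _ _ hz)) ?_, boundary_boundary _⟩
    have := boundary_mem_chains (ρ₂ _ _ hz)
    rw [map_sub, LinearMap.mem_ker.1 hz0, zero_sub] at this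
    simpa using neg_mem this
  · rintro z ⟨hz, hz0⟩
    constructor
    · rintro ⟨w, hw, hwz⟩
      simp only [LinearMap.comp_apply] at hwz
      -- With `∂ρz = ∂w` for a chain `w` of `Y`, the cycle `z` is the sum of the cycles `ρ z - w` in
      -- `Y₁` and `z - ρ z + w` in `Y₂`, and both bound.
      obtain ⟨a, ha, haz⟩ := h₁ (i + 1) (show ρ z - w ∈ Y₁.cycles K (i + 1) from
        ⟨sub_mem (ρ₁ _ _ hz) (hY₁ _ hw), by simp [hwz]⟩)
      obtain ⟨b, hb, hbz⟩ := h₂ (i + 1) (show (z - ρ z) + w ∈ Y₂.cycles K (i + 1) from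
        ⟨add_mem (ρ₂ _ _ hz) (hY₂ _ hw), by simp [hwz, LinearMap.mem_ker.1 hz0]⟩)
      refine ⟨a + b, add_mem (hX₁ _ ha) (hX₂ _ hb), ?_⟩
      rw [map_add, haz, hbz]
      abel
    · rintro ⟨x, hx, rfl⟩
      -- For `z = ∂x` this chain also equals `∂(x - ρx) - (z - ρz)`, so it lies in both `Y₁` and
      -- `Y₂`.
      refine ⟨ρ (boundary K x) - boundary K (ρ x), hYc _ _ ?_ ?_, ?_⟩
      · exact sub_mem (ρ₁ _ _ hz) (boundary_mem_chains (ρ₁ _ _ hx))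
      · have := sub_mem (boundary_mem_chains (ρ₂ _ _ hx)) (ρ₂ _ _ hz)
        rw [map_sub] at this
        convert this using 1
        abel
      · simp [boundary_boundary]
  · rintro y ⟨hy, hy0⟩
    obtain ⟨a, ha, hay⟩ := h₁ i (show y ∈ Y₁.cycles K i from ⟨hY₁ _ hy, hy0⟩)
    obtain ⟨b, hb, hby⟩ := h₂ i (show y ∈ Y₂.cycles K i from ⟨hY₂ _ hy, hy0⟩)
    -- Two fillings of `y`, one on each side, glue to a cycle of `X`. Since `ρ a = a`, the error is
    -- `∂ρb`, and `ρ b` lies in `Y`.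
    refine ⟨a - b, ⟨sub_mem (hX₁ _ ha) (hX₂ _ hb), by simp [hay, hby]⟩, ?_⟩
    refine ⟨ρ b, hYc _ _ (ρ₁ _ _ (hX₂ _ hb)) (ρ₄ _ _ hb), ?_⟩
    simp [ρ₃ _ _ ha, hay]

theorem neg_one_pow_filter_insert {F : Finset V} {w : V} (hw : w ∉ F) (p : V → Prop)
    [DecidablePred p] :
    (-1 : K) ^ ((insert w F).filter p).card =
      (if p w then -1 else 1) * (-1 : K) ^ (F.filter p).card := by
  rw [Finset.filter_insert]
  split_ifs
  · rw [Finset.card_insert_of_notMem (by simp [hw]), pow_succ]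
    ring
  · simp

theorem neg_one_pow_mul_self' (n : ℕ) : (-1 : K) ^ n * (-1) ^ n = 1 := by
  rw [← mul_pow]; simp

/-- A cone is acyclic. -/
theorem isAcyclic_of_cone (X : SComplex V) (v : V) (h : ∀ F ∈ X.faces, insert v F ∈ X.faces) :
    X.IsAcyclic K := by
  -- Joining with the apex, signed by its position in the enlarged face, is a contracting homotopy:
  -- `∂η + η∂ = id`.
  let η : (Finset V → K) →ₗ[K] (Finset V → K) := Fintype.linearCombination K fun F : Finset V =>
    if v ∈ F then 0 else Pi.single (insert v F) ((-1 : K) ^ (F.filter (· < v)).card)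
  have hη : ∀ (F : Finset V) (a : K), η (Pi.single F a) = if v ∈ F then 0 else
      Pi.single (insert v F) ((-1 : K) ^ (F.filter (· < v)).card * a) := by
    intro F a
    simp only [η, Fintype.linearCombination_apply_single]
    split_ifs
    · simp
    · rw [← Pi.single_smul, smul_eq_mul, mul_comm]
  have key : boundary K ∘ₗ η + η ∘ₗ boundary K = LinearMap.id := by
    ext1 F
    ext1
    simp only [LinearMap.add_apply, LinearMap.comp_apply, LinearMap.single_apply, boundary_single,
      one_smul, map_sum, LinearMap.id_apply, hη, mul_one]
    split_ifs with hv
    · rw [map_zero, zero_add, Finset.sum_eq_single_of_mem v hv]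
      · rw [if_neg (Finset.notMem_erase v F), Finset.insert_erase hv, Finset.filter_erase,
          Finset.erase_eq_of_notMem (by simp), neg_one_pow_mul_self']
      · intro w _ hw
        rw [if_pos (Finset.mem_erase.2 ⟨hw.symm, hv⟩)]
    · rw [boundary_single, Finset.sum_insert hv, smul_add, Finset.erase_insert hv,
        ← Pi.single_smul, smul_eq_mul, neg_one_pow_filter_insert hv, if_neg (lt_irrefl v), one_mul,
        neg_one_pow_mul_self', add_assoc, Finset.smul_sum, ← Finset.sum_add_distrib,
        Finset.sum_eq_zero, add_zero]
      intro w hw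
      have hwv : w ≠ v := by rintro rfl; exact hv hw
      have hv' : v ∉ F.erase w := fun h' => hv (Finset.mem_of_mem_erase h')
      rw [if_neg hv', ← Pi.single_smul, Finset.erase_insert_of_ne hwv.symm, ← Pi.single_add,
        Pi.single_eq_zero_iff, smul_eq_mul, neg_one_pow_filter_insert hv]
      have h1 : (-1 : K) ^ (F.filter (· < v)).card = (if w < v then -1 else 1) *
          (-1 : K) ^ ((F.erase w).filter (· < v)).card := by
        rw [← neg_one_pow_filter_insert (Finset.notMem_erase w F) (· < v), Finset.insert_erase hw]
      rw [h1]
      rcases lt_or_gt_of_ne hwv with hlt | hlt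
      · rw [if_pos hlt, if_neg hlt.not_gt]; ring
      · rw [if_neg hlt.not_gt, if_pos hlt]; ring
  have hmem : ∀ i c, c ∈ X.chains K i → η c ∈ X.chains K (i + 1) := by
    intro i c hc
    rw [chains_eq_span] at hc
    refine (Submodule.span_le (p := (X.chains K (i + 1)).comap η)).2 ?_ hc
    rintro _ ⟨F, h1, h2, rfl⟩
    rw [SetLike.mem_coe, Submodule.mem_comap, hη]
    split_ifs with hv
    · exact zero_mem _
    · rw [← smul_eq_mul, Pi.single_smul]
      refine Submodule.smul_mem _ _ (single_mem_chains (h _ h1) ?_)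
      rw [Finset.card_insert_of_notMem hv]
      push_cast
      lia
  rintro i z ⟨hz, hz0⟩
  refine ⟨η z, hmem i z hz, ?_⟩
  have := LinearMap.congr_fun key z
  simpa [LinearMap.mem_ker.1 hz0] using this

variable {W : Type*} [Fintype W] [LinearOrder W]

variable (K) in
/-- The sign of the permutation which sorts the images of the elements of `F` under `e`. -/
def inversionSign (e : W ↪ V) (F : Finset W) : K :=
  (-1) ^ ((F ×ˢ F).filter fun p => p.1 < p.2 ∧ e p.2 < e p.1).card

theorem inversionSign_mul_self (e : W ↪ V) (F : Finset W) :
    inversionSign K e F * inversionSign K e F = 1 := neg_one_pow_mul_self' _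

theorem neg_one_pow_filter_mul (F : Finset W) (p q r : W → Prop) [DecidablePred p]
    [DecidablePred q] [DecidablePred r] (h : ∀ w ∈ F, p w ↔ ¬ (q w ↔ r w)) :
    (-1 : K) ^ (F.filter p).card = (-1) ^ (F.filter q).card * (-1) ^ (F.filter r).card := by
  induction F using Finset.induction_on with
  | empty => simp
  | insert w F hw ih =>
    rw [neg_one_pow_filter_insert hw, neg_one_pow_filter_insert hw, neg_one_pow_filter_insert hw,
      ih fun x hx => h x (Finset.mem_insert_of_mem hx)]
    have := h w (Finset.mem_insert_self w F)
    by_cases h1 : q w <;> by_cases h2 : r w <;> simp [h1, h2, this]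

/-- The new inversions come from those `w` in `F` whose order relative to `v` is reversed by `e`,
i.e. for which exactly one of `w < v` and `e w < e v` holds. This sign change is what makes the
signed relabelling of simplices commute with the boundary. -/
theorem inversionSign_insert (e : W ↪ V) {F : Finset W} {v : W} (hv : v ∉ F) :
    inversionSign K e (insert v F) = inversionSign K e F *
      ((-1) ^ (F.filter (· < v)).card * (-1) ^ (F.filter (e · < e v)).card) := by
  rw [← neg_one_pow_filter_mul F (fun w => (w < v ∧ e v < e w) ∨ (v < w ∧ e w < e v))]
  · unfold inversionSign
    rw [← pow_add]
    congr 1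
    have : ((insert v F ×ˢ insert v F).filter fun p : W × W => p.1 < p.2 ∧ e p.2 < e p.1) =
        ((F ×ˢ F).filter fun p => p.1 < p.2 ∧ e p.2 < e p.1) ∪
        (F.filter fun w => (w < v ∧ e v < e w) ∨ (v < w ∧ e w < e v)).image
          (fun w => if w < v then (w, v) else (v, w)) := by
      ext ⟨a, b⟩
      simp only [Finset.mem_filter, Finset.mem_product, Finset.mem_insert, Finset.mem_union,
        Finset.mem_image]
      constructor
      · rintro ⟨⟨rfl | ha, rfl | hb⟩, h1, h2⟩
        · exact absurd h1 (lt_irrefl _)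
        · exact Or.inr ⟨b, ⟨hb, Or.inr ⟨h1, h2⟩⟩, by rw [if_neg h1.not_gt]⟩
        · exact Or.inr ⟨a, ⟨ha, Or.inl ⟨h1, h2⟩⟩, by rw [if_pos h1]⟩
        · exact Or.inl ⟨⟨ha, hb⟩, h1, h2⟩
      · rintro (⟨⟨ha, hb⟩, h⟩ | ⟨w, ⟨hw, ⟨h1, h2⟩ | ⟨h1, h2⟩⟩, hab⟩)
        · exact ⟨⟨Or.inr ha, Or.inr hb⟩, h⟩
        · rw [if_pos h1, Prod.mk.injEq] at hab
          obtain ⟨rfl, rfl⟩ := hab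
          exact ⟨⟨Or.inr hw, Or.inl rfl⟩, h1, h2⟩
        · rw [if_neg h1.not_gt, Prod.mk.injEq] at hab
          obtain ⟨rfl, rfl⟩ := hab
          exact ⟨⟨Or.inl rfl, Or.inr hw⟩, h1, h2⟩
    rw [this, Finset.card_union_of_disjoint, Finset.card_image_of_injOn]
    · intro a ha b hb hab
      simp only at hab
      split_ifs at hab <;> grind
    · rw [Finset.disjoint_left]
      rintro ⟨a, b⟩ h1 h2
      simp only [Finset.mem_filter, Finset.mem_product, Finset.mem_image] at h1 h2
      obtain ⟨w, -, hw⟩ := h2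
      split_ifs at hw <;> grind
  · intro w hw
    have hwv : w ≠ v := by rintro rfl; exact hv hw
    have hewv : e w ≠ e v := fun h => hwv (e.injective h)
    rcases lt_or_gt_of_ne hwv with h1 | h1 <;> rcases lt_or_gt_of_ne hewv with h2 | h2 <;>
      simp [h1, h2, h1.not_gt, h2.not_gt]

/-- Reduced homology does not depend on the labelling and the ordering of the vertices. -/
theorem nonempty_homology_equiv_of_embedding (X : SComplex V) (X' : SComplex W) (e : W ↪ V)
    (h : ∀ F, F ∈ X.faces ↔ ∃ G ∈ X'.faces, G.map e = F) (i : ℤ) :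
    Nonempty (ReducedHomology K X i ≃ₗ[K] ReducedHomology K X' i) := by
  let f : (Finset W → K) →ₗ[K] (Finset V → K) := Fintype.linearCombination K fun G : Finset W =>
    Pi.single (G.map e) (inversionSign K e G)
  have hf : ∀ (G : Finset W) (a : K),
      f (Pi.single G a) = Pi.single (G.map e) (inversionSign K e G * a) := by
    intro G a
    simp only [f, Fintype.linearCombination_apply_single]
    rw [← Pi.single_smul, smul_eq_mul, mul_comm]
  have hfapply : ∀ c G, f c (G.map e) = inversionSign K e G * c G := by
    intro c G
    simp only [f, Fintype.linearCombination_apply, Finset.sum_apply, Pi.smul_apply, smul_eq_mul]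
    rw [Finset.sum_eq_single G]
    · simp [mul_comm]
    · intro b _ hb
      rw [Pi.single_eq_of_ne, mul_zero]
      exact fun hh => hb (Finset.map_injective e hh).symm
    · simp
  have hinj : Function.Injective f := by
    rw [injective_iff_map_eq_zero]
    intro c hc
    ext G
    have h1 := hfapply c G
    rw [hc] at h1
    have h2 := congrArg (inversionSign K e G * ·) h1
    simpa [← mul_assoc, inversionSign_mul_self] using h2.symm
  have hcomm : boundary K ∘ₗ f = f ∘ₗ boundary K := by
    ext1 F
    ext1
    simp only [LinearMap.comp_apply, LinearMap.single_apply, hf, boundary_single, one_smul,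
      map_sum, Finset.smul_sum, ← Pi.single_smul, smul_eq_mul, mul_one, Finset.sum_map]
    refine Finset.sum_congr rfl fun v hv => ?_
    rw [← Finset.map_erase]
    congr 1
    obtain ⟨G, hvG, rfl⟩ : ∃ G, v ∉ G ∧ insert v G = F :=
      ⟨F.erase v, Finset.notMem_erase v F, Finset.insert_erase hv⟩
    rw [Finset.erase_insert hvG, inversionSign_insert e hvG, Finset.filter_map, Finset.card_map,
      neg_one_pow_filter_insert hvG, neg_one_pow_filter_insert hvG]
    simp only [Function.comp_apply, lt_irrefl, if_false, one_mul]
    rw [mul_assoc, mul_assoc, neg_one_pow_mul_self', mul_one]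
  have hcomm' : ∀ c, boundary K (f c) = f (boundary K c) := LinearMap.congr_fun hcomm
  have hch : ∀ k, (X'.chains K k).map f = X.chains K k := by
    intro k
    apply le_antisymm
    · rw [chains_eq_span X', Submodule.map_span, Submodule.span_le]
      rintro _ ⟨_, ⟨G, h1, h2, rfl⟩, rfl⟩
      rw [hf, ← smul_eq_mul, Pi.single_smul]
      exact Submodule.smul_mem _ _
        (single_mem_chains ((h _).2 ⟨G, h1, rfl⟩) (by rw [Finset.card_map, h2]))
    · rw [chains_eq_span X, Submodule.span_le]
      rintro _ ⟨F, h1, h2, rfl⟩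
      obtain ⟨G, hG, rfl⟩ := (h F).1 h1
      rw [Finset.card_map] at h2
      refine ⟨inversionSign K e G • Pi.single G 1,
        Submodule.smul_mem _ _ (single_mem_chains hG h2), ?_⟩
      rw [← Pi.single_smul, hf, smul_eq_mul, mul_one, inversionSign_mul_self]
  obtain ⟨E⟩ := nonempty_subquotient_equiv (X'.cycles K i) (X'.boundaries K i) (X.cycles K i)
    (X.boundaries K i) f
    (by
      rintro z ⟨hz, hz0⟩
      exact ⟨hch i ▸ ⟨z, hz, rfl⟩, by simp [hcomm', LinearMap.mem_ker.1 hz0]⟩)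
    (by
      rintro z ⟨hz, hz0⟩
      constructor
      · rintro ⟨x, hx, hxz⟩
        rw [← hch] at hx
        obtain ⟨y, hy, rfl⟩ := hx
        rw [hcomm'] at hxz
        exact ⟨y, hy, hinj hxz⟩
      · rintro ⟨y, hy, rfl⟩
        exact ⟨f y, hch _ ▸ ⟨y, hy, rfl⟩, hcomm' y⟩)
    (by
      rintro y ⟨hy, hy0⟩
      rw [← hch] at hy
      obtain ⟨z, hz, rfl⟩ := hy
      have hz0 : f (boundary K z) = 0 := by rw [← hcomm']; exact hy0
      exact ⟨z, ⟨hz, hinj (by rw [hz0, map_zero])⟩, by simp⟩)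
  exact ⟨E.symm⟩

end Homology

end SComplex
end RunHomology
-- Coordinates on a disjoint union of runs.
namespace RunHomology

/-- Consecutive integers which differ by one and never turn back form an interval. -/
theorem exists_affine_of_injective (g : ℕ → ℤ) (n : ℕ)
    (h1 : ∀ i, i + 1 < n → g (i + 1) = g i + 1 ∨ g i = g (i + 1) + 1)
    (h2 : ∀ i, i + 2 < n → g (i + 2) ≠ g i) :
    (∀ i < n, g i = g 0 + i) ∨ (∀ i < n, g i = g 0 - i) := by
  by_cases hn : n < 2
  · left
    intro i hi
    obtain rfl : i = 0 := by lia
    simp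
  rcases h1 0 (by lia) with h | h
  · left
    have : ∀ i, i + 1 < n → g (i + 1) = g i + 1 := by
      intro i
      induction i with
      | zero => exact fun _ => h
      | succ i ih =>
        intro hi
        have a := ih (by lia)
        have b := h2 i (by lia)
        rcases h1 (i + 1) hi with c | c
        · exact c
        · exact absurd (by rw [show i + 2 = i + 1 + 1 from rfl]; lia) b
    intro i
    induction i with
    | zero => simp
    | succ i ih =>
      intro hi
      rw [this i hi, ih (by lia)]
      push_cast; ring
  · right
    have : ∀ i, i + 1 < n → g i = g (i + 1) + 1 := by
      intro i
      induction i with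
      | zero => exact fun _ => h
      | succ i ih =>
        intro hi
        have a := ih (by lia)
        have b := h2 i (by lia)
        rcases h1 (i + 1) hi with c | c
        · exact absurd (by rw [show i + 2 = i + 1 + 1 from rfl]; lia) b
        · exact c
    intro i
    induction i with
    | zero => simp
    | succ i ih =>
      intro hi
      have a := this i hi
      have b := ih (by lia)
      push_cast; lia

/-- The faces of a run are the sets contained in one of the intervals with `t` elements. -/
theorem mem_run_faces {t p : ℕ} (ht : 2 ≤ t) (F : Finset (Fin (p + t - 1))) :
    F ∈ (run t p).faces ↔ ∃ k < p, ∀ x ∈ F, k ≤ x.val ∧ x.val < k + t := by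
  constructor
  · rintro ⟨G, ⟨f, hf, hG⟩, hFG⟩
    -- Integer values allow descending paths; the value 0 beyond the path is never used.
    obtain ⟨g, hg⟩ : ∃ g : ℕ → ℤ, ∀ i (h : i < t), g i = (f ⟨i, h⟩).val :=
      ⟨fun i => if h : i < t then (f ⟨i, h⟩).val else 0, fun i h => by simp [h]⟩
    have h1 : ∀ i, i + 1 < t → g (i + 1) = g i + 1 ∨ g i = g (i + 1) + 1 := by
      intro i hi
      rw [hg i (by omega), hg (i + 1) hi]
      have := f.map_adj (v := ⟨i, by omega⟩) (w := ⟨i + 1, hi⟩)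
        (by simp [SimpleGraph.pathGraph_adj])
      rw [SimpleGraph.pathGraph_adj] at this
      omega
    have h2 : ∀ i, i + 2 < t → g (i + 2) ≠ g i := by
      intro i hi heq
      rw [hg i (by omega), hg (i + 2) hi] at heq
      have := hf (Fin.ext (by exact_mod_cast heq))
      simp at this
    have key : ∀ x ∈ F, ∃ i < t, (x.val : ℤ) = g i := by
      intro x hx
      have : x ∈ Set.range f := hG ▸ (hFG hx : x ∈ (G : Set _))
      obtain ⟨⟨i, hi⟩, rfl⟩ := this
      exact ⟨i, hi, (hg i hi).symm⟩
    have hb := hg (t - 1) (by omega)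
    have hbd := (f ⟨t - 1, by omega⟩).isLt
    have hb0 := hg 0 (by omega)
    have hbd0 := (f ⟨0, by omega⟩).isLt
    rcases exists_affine_of_injective g t h1 h2 with h | h
    · have := h (t - 1) (by omega)
      refine ⟨(g 0).toNat, by omega, fun x hx => ?_⟩
      obtain ⟨i, hi, hxi⟩ := key x hx
      have := h i hi
      omega
    · have := h (t - 1) (by omega)
      refine ⟨(g (t - 1)).toNat, by omega, fun x hx => ?_⟩
      obtain ⟨i, hi, hxi⟩ := key x hx
      have := h i hi
      omega
  · rintro ⟨k, hk, hF⟩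
    let f : SimpleGraph.pathGraph t →g SimpleGraph.pathGraph (p + t - 1) :=
      { toFun := fun i => ⟨k + i.val, by have := i.isLt; omega⟩
        map_rel' := by
          intro a b hab
          rw [SimpleGraph.pathGraph_adj] at hab ⊢
          simp only
          omega }
    refine ⟨Finset.univ.image f, ⟨f, ?_, by simp⟩, ?_⟩
    · intro a b hab
      have : k + a.val = k + b.val := congrArg Fin.val hab
      exact Fin.ext (by omega)
    · intro x hx
      obtain ⟨a, b⟩ := hF x hx
      rw [Finset.mem_image]
      refine ⟨⟨x.val - k, by omega⟩, Finset.mem_univ _, Fin.ext ?_⟩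
      show k + (x.val - k) = x.val
      omega

/-- The interval with `t` elements which starts at `k` in the line number `j`. -/
def window {ι : Type*} (t : ℕ) (j : ι) (k : ℕ) : Set (ι × ℕ) :=
  {p | p.1 = j ∧ k ≤ p.2 ∧ p.2 < k + t}

/-- A vertex is sent to the index of its component and its position in the corresponding run. Any
two vertices of a face span an edge, so a nonempty face stays in one component. -/
theorem ComponentsAreRuns.exists_coordinates_faces {V ι : Type*} [DecidableEq V]
    [Nonempty ι] {t : ℕ} (ht : 2 ≤ t) {Γ : SComplex V} {s : ι → ℕ}
    (hΓ : ComponentsAreRuns t Γ s) :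
    ∃ φ : V → ι × ℕ, Function.Injective φ ∧ (∀ p, p ∈ Set.range φ ↔ p.2 + 1 < s p.1 + t) ∧
      ∀ F, F ∈ Γ.faces ↔ ∃ j, ∃ k < s j, ∀ v ∈ F, φ v ∈ window t j k := by
  obtain ⟨hs, c, hc⟩ := hΓ
  choose e he using hc
  let J : V → ι := fun v => c.symm (Γ.edgeGraph.connectedComponentMk v)
  have hJ : ∀ v j, J v = j ↔ v ∈ (c j).supp := by
    intro v j
    rw [SimpleGraph.ConnectedComponent.mem_supp_iff, ← Equiv.symm_apply_eq]
  let φ : V → ι × ℕ := fun v => (J v, (e (J v) ⟨v, (hJ v _).1 rfl⟩).val)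
  have hφ : ∀ j v (h : v ∈ (c j).supp), φ v = (j, (e j ⟨v, h⟩).val) := by
    intro j v h
    obtain rfl := (hJ v j).2 h
    rfl
  have hφ1 : ∀ v, v ∈ (c (φ v).1).supp := fun v => (hJ v _).1 rfl
  refine ⟨φ, ?_, ?_, ?_⟩
  · intro v w hvw
    have hv := hφ1 v
    have hw := hφ1 w
    rw [← hvw] at hw
    have h := hvw
    rw [hφ _ v hv, hφ _ w hw, Prod.mk.injEq] at h
    have := (e _).injective (Fin.ext h.2)
    exact congrArg Subtype.val this
  · rintro ⟨j, m⟩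
    constructor
    · rintro ⟨v, hv⟩
      have h := hφ1 v
      rw [hv] at h
      have h' := hφ _ v h
      rw [hv, Prod.mk.injEq] at h'
      have := (e j ⟨v, h⟩).isLt
      simp only at h' ⊢
      lia
    · intro h
      simp only at h
      refine ⟨((e j).symm ⟨m, by lia⟩).1, ?_⟩
      rw [hφ j _ ((e j).symm ⟨m, by lia⟩).2]
      simp
  · have main : ∀ j F, (∀ v ∈ F, v ∈ (c j).supp) →
        (F ∈ Γ.faces ↔ ∃ k < s j, ∀ v ∈ F, φ v ∈ window t j k) := by
      intro j F hF
      classical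
      have h1 := he j (F.subtype (· ∈ (c j).supp))
      have h2 : F ∈ Γ.faces ↔ F.subtype (· ∈ (c j).supp) ∈ (Γ.restrict (c j).supp).faces := by
        show _ ↔ Finset.map _ _ ∈ Γ.faces
        rw [Finset.subtype_map_of_mem hF]
      rw [h2, h1, mem_run_faces ht]
      refine exists_congr fun k => and_congr_right fun _ => ?_
      simp only [Finset.forall_mem_map, Finset.mem_subtype, Subtype.forall]
      constructor
      · intro h v hv
        rw [hφ j v (hF v hv)]
        exact ⟨rfl, h v (hF v hv) hv⟩
      · intro h v hv hvF
        have := h v hvF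
        rw [hφ j v hv] at this
        exact this.2
    intro F
    constructor
    · intro hF
      rcases F.eq_empty_or_nonempty with rfl | ⟨u, hu⟩
      -- The empty face selects no component; any line will do, since each has a window.
      · exact ⟨Classical.arbitrary ι, 0, hs _, by simp⟩
      · refine ⟨J u, (main (J u) F fun v hv => ?_).1 hF⟩
        rw [← hJ]
        by_cases huv : u = v
        · rw [huv]
        · refine congrArg c.symm (SimpleGraph.ConnectedComponent.sound ?_)
          refine SimpleGraph.Adj.reachable ⟨Ne.symm huv, Γ.down_closed F hF _ ?_⟩
          simp [Finset.insert_subset_iff, hu, hv]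
    · rintro ⟨j, k, hk, h⟩
      refine (main j F fun v hv => ?_).2 ⟨k, hk, h⟩
      exact (hJ v j).1 (h v hv).1

/-- Coordinates in which a set is a face of the complement if and only if it is disjoint from one
of the intervals. -/
theorem ComponentsAreRuns.exists_coordinates {V ι : Type*} [Fintype V] [DecidableEq V]
    [Nonempty ι] {t : ℕ} (ht : 2 ≤ t) {Γ : SComplex V} {s : ι → ℕ}
    (hΓ : ComponentsAreRuns t Γ s) :
    ∃ φ : V → ι × ℕ, Function.Injective φ ∧ (∀ p, p ∈ Set.range φ ↔ p.2 + 1 < s p.1 + t) ∧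
      ∀ F, F ∈ Γ.compl.faces ↔ ∃ j, ∃ k < s j, ∀ v ∈ F, φ v ∉ window t j k := by
  classical
  obtain ⟨φ, hφ, hr, hF⟩ := hΓ.exists_coordinates_faces ht
  refine ⟨φ, hφ, hr, fun F => ?_⟩
  let E : ι → ℕ → Finset V := fun j k => Finset.univ.filter (φ · ∈ window t j k)
  have hE : ∀ j k v, v ∈ E j k ↔ φ v ∈ window t j k := by simp [E]
  have hEf : ∀ j, ∀ k < s j, E j k ∈ Γ.faces :=
    fun j k hk => (hF _).2 ⟨j, k, hk, fun v hv => (hE _ _ _).1 hv⟩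
  -- Windows are pairwise incomparable: containing both endpoints of one window forces the same line
  -- and the same start.
  have hmax : ∀ j, ∀ k < s j, E j k ∈ Γ.facets := by
    intro j k hk
    refine ⟨hEf j k hk, fun G hG hle => ?_⟩
    obtain ⟨j', k', hk', hG'⟩ := (hF G).1 hG
    obtain ⟨v, hv⟩ := (hr (j, k)).2 (by simp only; lia)
    obtain ⟨w, hw⟩ := (hr (j, k + t - 1)).2 (by simp only; lia)
    have h1 := hG' v (hle ((hE j k v).2 (by rw [hv]; exact ⟨rfl, by simp only; lia⟩)))
    have h2 := hG' w (hle ((hE j k w).2 (by rw [hw]; exact ⟨rfl, by simp only; lia⟩)))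
    rw [hv] at h1
    rw [hw] at h2
    obtain ⟨rfl, h3⟩ := h1
    obtain ⟨-, h4⟩ := h2
    simp only at h3 h4
    obtain rfl : k = k' := by lia
    exact fun x hx => (hE _ _ _).2 (hG' x hx)
  constructor
  · rintro ⟨_, ⟨M, hM, rfl⟩, hFM⟩
    obtain ⟨j, k, hk, h⟩ := (hF M).1 hM.1
    refine ⟨j, k, hk, fun v hv hvw => ?_⟩
    have hle : E j k ≤ M := hM.2 (hEf j k hk) fun x hx => (hE _ _ _).2 (h x hx)
    exact Finset.mem_compl.1 (hFM hv) (hle ((hE _ _ _).2 hvw))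
  · rintro ⟨j, k, hk, h⟩
    exact ⟨_, ⟨E j k, hmax j k hk, rfl⟩,
      fun v hv => Finset.mem_compl.2 fun hvE => h v hv ((hE _ _ _).1 hvE)⟩

end RunHomology
-- Complexes of sets that miss a member of a family.
namespace RunHomology
open SComplex

/-- The sets `F` of vertices which lie in `A` and are disjoint from a member of `H`, in the
coordinates `φ`. -/
def missing {V α : Type*} (φ : V → α) (A : Set α) (H : Set (Set α)) : SComplex V where
  faces := {F | (∀ v ∈ F, φ v ∈ A) ∧ ∃ E ∈ H, ∀ v ∈ F, φ v ∉ E}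
  down_closed := by
    rintro F ⟨h, E, hE, hF⟩ G hG
    exact ⟨fun v hv => h v (hG hv), E, hE, fun v hv => hF v (hG hv)⟩

section Missing

variable (K : Type*) [Field K] {V α : Type*} [Fintype V] [LinearOrder V] {φ : V → α}
  {A : Set α} {H : Set (Set α)}

/-- The complex is a cone with apex `u`: a face missing `E` also misses `E'`, and still does after
`u` is added. -/
theorem isAcyclic_missing (u : V) (hu : φ u ∈ A)
    (h : ∀ E ∈ H, ∃ E' ∈ H, φ u ∉ E' ∧ E' ∩ A ⊆ E) : (missing φ A H).IsAcyclic K := by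
  refine isAcyclic_of_cone _ u ?_
  rintro F ⟨hF, E, hE, hFE⟩
  obtain ⟨E', hE', h1, h2⟩ := h E hE
  refine ⟨?_, E', hE', ?_⟩ <;> simp only [Finset.mem_insert, forall_eq_or_imp]
  · exact ⟨hu, hF⟩
  · exact ⟨h1, fun v hv hv' => hFE v hv (h2 ⟨hv', hF v hv⟩)⟩

/-- If deleting a vertex leaves an acyclic complex, the homology is that of its link. -/
theorem nonempty_homology_equiv_link (hφ : Function.Injective φ) (u : V) (hu : φ u ∈ A)
    (h : (missing φ (A \ {φ u}) H).IsAcyclic K) (i : ℤ) :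
    Nonempty (ReducedHomology K (missing φ A H) (i + 1) ≃ₗ[K]
      ReducedHomology K (missing φ (A \ {φ u}) {E ∈ H | φ u ∉ E}) i) := by
  -- The star of `u`, a cone, and the deletion of `u` cover the complex and meet in the link.
  refine nonempty_homology_equiv_of_union (Y₁ := missing φ A {E ∈ H | φ u ∉ E}) ?_ ?_
    (isAcyclic_missing K u hu fun E hE => ⟨E, hE, hE.2, Set.inter_subset_left⟩) h i
  · ext F
    constructor
    · rintro ⟨hF, E, hE, hFE⟩
      by_cases huF : u ∈ F
      · exact Or.inl ⟨hF, E, ⟨hE, hFE u huF⟩, hFE⟩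
      · refine Or.inr ⟨fun v hv => ⟨hF v hv, fun hvu => huF ?_⟩, E, hE, hFE⟩
        rwa [← hφ (Set.mem_singleton_iff.1 hvu)]
    · rintro (⟨hF, E, hE, hFE⟩ | ⟨hF, E, hE, hFE⟩)
      · exact ⟨hF, E, hE.1, hFE⟩
      · exact ⟨fun v hv => (hF v hv).1, E, hE, hFE⟩
  · ext F
    constructor
    · rintro ⟨hF, E, hE, hFE⟩
      exact ⟨⟨fun v hv => (hF v hv).1, E, hE, hFE⟩, hF, E, hE.1, hFE⟩
    · rintro ⟨⟨_, E, hE, hFE⟩, hF, -⟩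
      exact ⟨hF, E, hE, hFE⟩

/-- Removing a member of `H` which is disjoint from the others. -/
theorem nonempty_homology_equiv_of_disjoint {E : Set α} (hE : ∀ E' ∈ H, Disjoint E E') (u w : V)
    (hu : φ u ∈ A) (huE : φ u ∈ E) (hw : φ w ∈ A) (hwE : φ w ∉ E) (i : ℤ) :
    Nonempty (ReducedHomology K (missing φ A (insert E H)) (i + 1) ≃ₗ[K]
      ReducedHomology K (missing φ (A \ E) H) i) := by
  -- The first piece is the full simplex on `A \ E`, where `w` ensures that it has a vertex. The
  -- second is a cone with apex `u`, which by disjointness lies in no member of `H`.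
  refine nonempty_homology_equiv_of_union (Y₁ := missing φ A {E}) (Y₂ := missing φ A H) ?_ ?_
    (isAcyclic_missing K w hw ?_) (isAcyclic_missing K u hu fun E' hE' =>
      ⟨E', hE', Set.disjoint_left.1 (hE E' hE') huE, Set.inter_subset_left⟩) i
  · ext F
    constructor
    · rintro ⟨hF, E', rfl | hE', hFE⟩
      · exact Or.inl ⟨hF, E', rfl, hFE⟩
      · exact Or.inr ⟨hF, E', hE', hFE⟩
    · rintro (⟨hF, E', hE', hFE⟩ | ⟨hF, E', hE', hFE⟩)
      · exact ⟨hF, E', Or.inl hE', hFE⟩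
      · exact ⟨hF, E', Or.inr hE', hFE⟩
  · ext F
    constructor
    · rintro ⟨hF, E', hE', hFE⟩
      exact ⟨⟨fun v hv => (hF v hv).1, E, rfl, fun v hv => (hF v hv).2⟩,
        fun v hv => (hF v hv).1, E', hE', hFE⟩
    · rintro ⟨⟨hF, _, rfl, hFE⟩, -, E', hE', hFE'⟩
      exact ⟨fun v hv => ⟨hF v hv, hFE v hv⟩, E', hE', hFE'⟩
  · rintro _ rfl
    exact ⟨_, rfl, hwE, Set.inter_subset_left⟩

/-- Points outside `A` remain in the ambient type without being vertices of the complex, so `W` is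
only embedded in `V`, with image the points of `A`. -/
theorem nonempty_homology_equiv_of_relabel {W β : Type*} [Fintype W] [LinearOrder W] {ψ : W → β}
    {H' : Set (Set β)} (hφ : Function.Injective φ) (hψ : Function.Injective ψ) {θ : β → α}
    (hθ : Function.Injective θ) (hA : ∀ p, (p ∈ Set.range φ ∧ p ∈ A) ↔ ∃ w, θ (ψ w) = p)
    (h₁ : ∀ E' ∈ H', ∃ E ∈ H, θ ⁻¹' E = E') (h₂ : ∀ E ∈ H, θ ⁻¹' E ∈ H') (i : ℤ) :
    Nonempty (ReducedHomology K (missing φ A H) i ≃ₗ[K]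
      ReducedHomology K (missing ψ Set.univ H') i) := by
  have he : ∀ w, ∃ v, φ v = θ (ψ w) := fun w => ((hA _).2 ⟨w, rfl⟩).1
  choose e he using he
  have hinj : Function.Injective e := fun a b hab =>
    hψ (hθ (by rw [← he, ← he, hab]))
  refine nonempty_homology_equiv_of_embedding _ _ ⟨e, hinj⟩ (fun F => ?_) i
  constructor
  · rintro ⟨hF, E, hE, hFE⟩
    refine ⟨F.preimage e hinj.injOn, ⟨fun _ _ => trivial, _, h₂ E hE, fun w hw => ?_⟩, ?_⟩
    · rw [Set.mem_preimage, ← he]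
      exact hFE _ (Finset.mem_preimage.1 hw)
    · ext v
      simp only [Finset.mem_map, Finset.mem_preimage, Function.Embedding.coeFn_mk]
      constructor
      · rintro ⟨w, hw, rfl⟩
        exact hw
      · intro hv
        obtain ⟨w, hw⟩ := (hA (φ v)).1 ⟨⟨v, rfl⟩, hF v hv⟩
        have : e w = v := hφ (by rw [he, hw])
        exact ⟨w, by rwa [this], this⟩
  · rintro ⟨G, ⟨-, E', hE', hG⟩, rfl⟩
    obtain ⟨E, hE, rfl⟩ := h₁ E' hE'
    refine ⟨?_, E, hE, ?_⟩ <;>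
      simp only [Finset.mem_map, Function.Embedding.coeFn_mk, forall_exists_index, and_imp,
        forall_apply_eq_imp_iff₂]
    · intro w _
      rw [he]
      exact ((hA _).2 ⟨w, rfl⟩).2
    · intro w hw
      rw [he]
      exact hG w hw

end Missing

/-! ### Shortening one line from its left end. -/

section Tail

variable {ι : Type*}

/-- All intervals with `t` elements in lines, the line `l` containing `s l` of them. -/
def windows (t : ℕ) (s : ι → ℕ) : Set (Set (ι × ℕ)) :=
  {E | ∃ l, ∃ k < s l, E = window t l k}

/-- Everything except the points before `a` in the line number `j`. -/
def tailPoints (j : ι) (a : ℕ) : Set (ι × ℕ) := {p | p.1 = j → a ≤ p.2}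

/-- All intervals except those which start before `a` in the line number `j`. -/
def tailWindows (t : ℕ) (s : ι → ℕ) (j : ι) (a : ℕ) : Set (Set (ι × ℕ)) :=
  {E | ∃ l, ∃ k < s l, (l = j → a ≤ k) ∧ E = window t l k}

theorem tailPoints_zero (j : ι) : tailPoints j 0 = Set.univ := by
  ext; simp [tailPoints]

theorem tailWindows_zero (t : ℕ) (s : ι → ℕ) (j : ι) : tailWindows t s j 0 = windows t s := by
  ext; simp [tailWindows, windows]

theorem mem_window {t : ℕ} {j l : ι} {k m : ℕ} :
    (l, m) ∈ window t j k ↔ l = j ∧ k ≤ m ∧ m < k + t := Iff.rfl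

theorem disjoint_window_tailWindows {t : ℕ} {s : ι → ℕ} {j : ι} {a b : ℕ} (hab : a + t ≤ b)
    (E : Set (ι × ℕ)) (hE : E ∈ tailWindows t s j b) : Disjoint (window t j a) E := by
  obtain ⟨l, k, -, hk, rfl⟩ := hE
  rw [Set.disjoint_left]
  rintro ⟨x, m⟩ h1 h2
  rw [mem_window] at h1 h2
  have := hk (h2.1.symm.trans h1.1)
  omega

variable (K : Type*) [Field K] {V : Type*} [Fintype V] [LinearOrder V] {φ : V → ι × ℕ}
  {t : ℕ} {s : ι → ℕ}

theorem nonempty_homology_equiv_tail_link (ht : 2 ≤ t) (hφ : Function.Injective φ)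
    (hr : ∀ p, p ∈ Set.range φ ↔ p.2 + 1 < s p.1 + t) {j : ι} {a : ℕ} (ha : a + 2 ≤ s j) (i : ℤ) :
    Nonempty (ReducedHomology K (missing φ (tailPoints j a) (tailWindows t s j a)) (i + 1) ≃ₗ[K]
      ReducedHomology K (missing φ (tailPoints j a \ {(j, a + t)})
        (insert (window t j a) (tailWindows t s j (a + t + 1)))) i) := by
  obtain ⟨u, hu⟩ := (hr (j, a + t)).2 (by simp only; omega)
  obtain ⟨w, hw⟩ := (hr (j, a)).2 (by simp only; omega)
  have hH : {E ∈ tailWindows t s j a | φ u ∉ E} =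
      insert (window t j a) (tailWindows t s j (a + t + 1)) := by
    ext E
    constructor
    · rintro ⟨⟨l, k, hk, hl, rfl⟩, hE⟩
      rw [hu, mem_window] at hE
      by_cases hlj : l = j
      · subst hlj
        have := hl rfl
        by_cases hka : k = a
        · exact Or.inl (by rw [hka])
        · refine Or.inr ⟨l, k, hk, fun _ => ?_, rfl⟩
          by_contra
          exact hE ⟨rfl, by omega⟩
      · exact Or.inr ⟨l, k, hk, fun h => absurd h hlj, rfl⟩
    · rintro (rfl | ⟨l, k, hk, hl, rfl⟩)
      · refine ⟨⟨j, a, by omega, fun _ => le_rfl, rfl⟩, ?_⟩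
        rw [hu, mem_window]
        omega
      · refine ⟨⟨l, k, hk, fun h => by have := hl h; omega, rfl⟩, ?_⟩
        rw [hu, mem_window]
        rintro ⟨h, h'⟩
        have := hl h.symm
        omega
  have := nonempty_homology_equiv_link K (A := tailPoints j a) (H := tailWindows t s j a) hφ u
    (by rw [hu]; exact fun _ => Nat.le_add_right _ _) ?_ i
  · rwa [hH, hu] at this
  · refine isAcyclic_missing K w ?_ ?_
    · rw [hw, hu]
      refine ⟨fun _ => le_rfl, fun h => ?_⟩
      have := congrArg Prod.snd (Set.mem_singleton_iff.1 h)
      simp only at this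
      omega
    · rintro _ ⟨l, k, hk, hl, rfl⟩
      by_cases h : l = j ∧ k = a
      · obtain ⟨rfl, rfl⟩ := h
        -- Without the deleted point `k + t`, the next window lies inside this one and avoids the
        -- apex `k`. It exists because at least two windows remain.
        refine ⟨window t l (k + 1), ⟨l, k + 1, by omega, fun _ => by omega, rfl⟩, ?_, ?_⟩
        · rw [hw, mem_window]
          omega
        · rintro ⟨x, m⟩ ⟨h1, h2, h3⟩
          rw [mem_window] at h1 ⊢
          obtain ⟨rfl, h1⟩ := h1
          have hm : m ≠ k + t := by
            rintro rfl
            exact h3 hu.symm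
          exact ⟨rfl, by omega⟩
      · refine ⟨_, ⟨l, k, hk, hl, rfl⟩, ?_, Set.inter_subset_left⟩
        rw [hw, mem_window]
        rintro ⟨h1, h2⟩
        have := hl h1.symm
        exact h ⟨h1.symm, by omega⟩

/-- Passing to the link isolates the first window, which is then removed. The hypothesis `hne`
provides a point outside that window. -/
theorem nonempty_homology_equiv_tail (ht : 2 ≤ t) (hφ : Function.Injective φ)
    (hr : ∀ p, p ∈ Set.range φ ↔ p.2 + 1 < s p.1 + t) {j : ι} {a : ℕ} (ha : a + 2 ≤ s j)
    (hne : (tailWindows t s j (a + t + 1)).Nonempty) (i : ℤ) :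
    Nonempty (ReducedHomology K (missing φ (tailPoints j a) (tailWindows t s j a)) (i + 1 + 1)
      ≃ₗ[K] ReducedHomology K
        (missing φ (tailPoints j (a + t + 1)) (tailWindows t s j (a + t + 1))) i) := by
  obtain ⟨e₁⟩ := nonempty_homology_equiv_tail_link K ht hφ hr ha (i + 1)
  obtain ⟨_, l, k, hk, hl, rfl⟩ := hne
  obtain ⟨u, hu⟩ := (hr (j, a)).2 (by simp only; omega)
  obtain ⟨w, hw⟩ := (hr (l, k)).2 (by simp only; omega)
  obtain ⟨e₂⟩ := nonempty_homology_equiv_of_disjoint K (φ := φ)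
    (A := tailPoints j a \ {(j, a + t)}) (H := tailWindows t s j (a + t + 1))
    (E := window t j a) (disjoint_window_tailWindows (by omega)) u w
    (by
      rw [hu]
      refine ⟨fun _ => le_rfl, fun h => ?_⟩
      have := congrArg Prod.snd (Set.mem_singleton_iff.1 h)
      simp only at this
      omega)
    (by rw [hu, mem_window]; exact ⟨rfl, by omega⟩)
    (by
      rw [hw]
      refine ⟨fun h => ?_, fun h => ?_⟩
      · have := hl h
        simp only
        omega
      · obtain ⟨h1, h2⟩ := Prod.mk.inj (Set.mem_singleton_iff.1 h)
        have := hl h1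
        omega)
    (by
      rw [hw, mem_window]
      rintro ⟨h1, h2⟩
      have := hl h1
      omega) i
  have hA : (tailPoints j a \ {(j, a + t)}) \ window t j a = tailPoints j (a + t + 1) := by
    ext ⟨x, m⟩
    simp only [tailPoints, Set.mem_sdiff, Set.mem_ofPred_eq, Set.mem_singleton_iff, Prod.mk.injEq,
      mem_window]
    by_cases hx : x = j
    · simp only [hx, true_and, forall_const]
      omega
    · simp [hx]
  rw [hA] at e₂
  exact ⟨e₁.trans e₂⟩

theorem nonempty_homology_equiv_of_single (ht : 2 ≤ t)
    (hr : ∀ p, p ∈ Set.range φ ↔ p.2 + 1 < s p.1 + t) {j : ι} (hj : s j = 1)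
    (hne : (tailWindows t s j t).Nonempty) (i : ℤ) :
    Nonempty (ReducedHomology K (missing φ Set.univ (windows t s)) (i + 1)
      ≃ₗ[K] ReducedHomology K (missing φ (tailPoints j t) (tailWindows t s j t)) i) := by
  obtain ⟨_, l, k, hk, hl, rfl⟩ := hne
  obtain ⟨u, hu⟩ := (hr (j, 0)).2 (by simp only; omega)
  obtain ⟨w, hw⟩ := (hr (l, k)).2 (by simp only; omega)
  have e := nonempty_homology_equiv_of_disjoint K (φ := φ)
    (A := Set.univ) (H := tailWindows t s j t)
    (E := window t j 0) (disjoint_window_tailWindows (by omega)) u w trivial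
    (by rw [hu, mem_window]; exact ⟨rfl, by omega⟩) trivial
    (by
      rw [hw, mem_window]
      rintro ⟨h1, h2⟩
      have := hl h1
      omega) i
  have hA : Set.univ \ window t j 0 = tailPoints j t := by
    ext ⟨x, m⟩
    simp only [tailPoints, Set.mem_sdiff, Set.mem_univ, Set.mem_ofPred_eq, mem_window, true_and]
    by_cases hx : x = j
    · simp [hx]
    · simp [hx]
  have hH : insert (window t j 0) (tailWindows t s j t) = windows t s := by
    ext E
    constructor
    · rintro (rfl | ⟨l, k, hk, -, rfl⟩)
      · exact ⟨j, 0, by omega, rfl⟩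
      · exact ⟨l, k, hk, rfl⟩
    · rintro ⟨l, k, hk, rfl⟩
      by_cases hlj : l = j
      · subst hlj
        exact Or.inl (by rw [show k = 0 by omega])
      · exact Or.inr ⟨l, k, hk, fun h => absurd h hlj, rfl⟩
  rwa [hA, hH] at e

/-- Induction on the number `n` of remaining windows, in steps of `t + 1`. The residues 1 and 2 are
exactly those that would end at `n = 1` or `n = 2`; residue 0 ends at `n = t + 1`. -/
theorem subsingleton_homology_tail (ht : 2 ≤ t) (hφ : Function.Injective φ)
    (hr : ∀ p, p ∈ Set.range φ ↔ p.2 + 1 < s p.1 + t) {j : ι} (n a : ℕ) (hn : s j = a + n)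
    (hn0 : n ≠ 0) (h1 : n % (t + 1) ≠ 1) (h2 : n % (t + 1) ≠ 2) (i : ℤ) :
    Subsingleton
      (ReducedHomology K (missing φ (tailPoints j a) (tailWindows t s j a)) i) := by
  induction n using Nat.strong_induction_on generalizing a i with
  | _ n ih =>
    have hn1 : n ≠ 1 := by
      rintro rfl
      exact h1 (Nat.mod_eq_of_lt (by omega))
    have hn2 : n ≠ 2 := by
      rintro rfl
      exact h2 (Nat.mod_eq_of_lt (by omega))
    obtain ⟨i, rfl⟩ : ∃ k, i = k + 1 + 1 := ⟨i - 1 - 1, by ring⟩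
    by_cases hnt : n ≤ t + 1
    · obtain ⟨e⟩ := nonempty_homology_equiv_tail_link K ht hφ hr (j := j) (a := a) (by omega)
        (i + 1)
      -- This vertex exists because `n ≥ 3`. As `n ≤ t + 1`, no window of line `j` starting after `a
      -- + t` remains, so it is a cone apex of the link.
      obtain ⟨u, hu⟩ := (hr (j, a + t + 1)).2 (by simp only; omega)
      have := (isAcyclic_missing K (φ := φ) (A := tailPoints j a \ {(j, a + t)})
        (H := insert (window t j a) (tailWindows t s j (a + t + 1))) u
        (by
          rw [hu]
          refine ⟨fun _ => by simp only; omega, fun h => ?_⟩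
          have := congrArg Prod.snd (Set.mem_singleton_iff.1 h)
          simp only at this
          omega)
        (by
          intro E hE
          refine ⟨E, hE, ?_, Set.inter_subset_left⟩
          rw [hu]
          rcases hE with rfl | ⟨l, k, hk, hl, rfl⟩
          · rw [mem_window]
            omega
          · rw [mem_window]
            rintro ⟨rfl, -⟩
            have := hl rfl
            omega)).subsingleton (i + 1)
      exact e.toEquiv.subsingleton
    · obtain ⟨m, rfl⟩ : ∃ m, n = m + (t + 1) := ⟨n - (t + 1), by omega⟩
      rw [Nat.add_mod_right] at h1 h2
      obtain ⟨e⟩ := nonempty_homology_equiv_tail K ht hφ hr (j := j) (a := a) (by omega)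
        ⟨_, j, a + t + 1, by omega, fun _ => le_rfl, rfl⟩ i
      have := ih m (by omega) (a + t + 1) (by omega) (by omega) h1 h2 i
      exact e.toEquiv.subsingleton

theorem ComponentsAreRuns.exists_compl_eq_missing [Nonempty ι] (ht : 2 ≤ t) {Γ : SComplex V}
    (hΓ : ComponentsAreRuns t Γ s) :
    ∃ φ : V → ι × ℕ, Function.Injective φ ∧ (∀ p, p ∈ Set.range φ ↔ p.2 + 1 < s p.1 + t) ∧
      Γ.compl = missing φ Set.univ (windows t s) := by
  obtain ⟨φ, h1, h2, h3⟩ := hΓ.exists_coordinates ht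
  refine ⟨φ, h1, h2, ?_⟩
  have : Γ.compl.faces = (missing φ Set.univ (windows t s)).faces := by
    ext F
    rw [h3]
    constructor
    · rintro ⟨j, k, hk, h⟩
      exact ⟨fun _ _ => trivial, _, ⟨j, k, hk, rfl⟩, h⟩
    · rintro ⟨-, _, ⟨j, k, hk, rfl⟩, h⟩
      exact ⟨j, k, hk, h⟩
  cases h : Γ.compl
  simp only [h] at this
  subst this
  rfl

theorem nonempty_homology_equiv_shorten [DecidableEq ι] (hφ : Function.Injective φ)
    (hr : ∀ p, p ∈ Set.range φ ↔ p.2 + 1 < s p.1 + t) {W : Type*} [Fintype W] [LinearOrder W]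
    {ψ : W → ι × ℕ} {j : ι} {a : ℕ} (ha : a ≤ s j) (hψ : Function.Injective ψ)
    (hr' : ∀ p, p ∈ Set.range ψ ↔ p.2 + 1 < Function.update s j (s j - a) p.1 + t) (i : ℤ) :
    Nonempty (ReducedHomology K (missing φ (tailPoints j a) (tailWindows t s j a)) i ≃ₗ[K]
      ReducedHomology K
        (missing ψ Set.univ (windows t (Function.update s j (s j - a)))) i) := by
  -- Translating line `j` by `a` identifies the shortened line with the tail.
  let θ : ι × ℕ → ι × ℕ := fun p => (p.1, if p.1 = j then p.2 + a else p.2)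
  have hθj : ∀ m, θ (j, m) = (j, m + a) := fun m => by simp [θ]
  have hθ : ∀ l m, l ≠ j → θ (l, m) = (l, m) := fun l m h => by simp [θ, h]
  have hpre : ∀ k, θ ⁻¹' window t j (k + a) = window t j k := by
    intro k
    ext ⟨x, m⟩
    by_cases hx : x = j
    · subst hx
      simp only [Set.mem_preimage, hθj, mem_window, true_and]
      omega
    · simp [hθ x m hx, mem_window, hx]
  have hpre' : ∀ l k, l ≠ j → θ ⁻¹' window t l k = window t l k := by
    intro l k hl
    ext ⟨x, m⟩
    by_cases hx : x = j
    · subst hx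
      simp [hθj, mem_window, hl.symm]
    · rw [Set.mem_preimage, hθ x m hx]
  refine nonempty_homology_equiv_of_relabel K hφ hψ (θ := θ) ?_ ?_ ?_ ?_ i
  · rintro ⟨x, m⟩ ⟨y, n⟩ h
    obtain ⟨h1, h2⟩ := Prod.mk.inj h
    simp only at h1 h2
    subst h1
    split_ifs at h2 with hx
    · exact Prod.ext rfl (by simp only; omega)
    · exact Prod.ext rfl h2
  · rintro ⟨x, m⟩
    rw [hr]
    constructor
    · rintro ⟨h1, h2⟩
      by_cases hx : x = j
      · subst hx
        have h2 : a ≤ m := h2 rfl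
        obtain ⟨w, hw⟩ := (hr' (x, m - a)).2 (by simp at h1 ⊢; omega)
        exact ⟨w, by rw [hw, hθj]; congr 1; omega⟩
      · obtain ⟨w, hw⟩ := (hr' (x, m)).2 (by simpa [hx] using h1)
        exact ⟨w, by rw [hw, hθ x m hx]⟩
    · rintro ⟨w, hw⟩
      have h3 := (hr' _).1 ⟨w, rfl⟩
      generalize ψ w = p at hw h3
      obtain ⟨y, n⟩ := p
      by_cases hy : y = j
      · subst hy
        rw [hθj, Prod.mk.injEq] at hw
        obtain ⟨rfl, rfl⟩ := hw
        simp only [Function.update_self] at h3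
        exact ⟨by simp only; omega, fun _ => Nat.le_add_left _ _⟩
      · rw [hθ y n hy, Prod.mk.injEq] at hw
        obtain ⟨rfl, rfl⟩ := hw
        simp only [Function.update_of_ne hy] at h3
        exact ⟨h3, fun h => absurd h hy⟩
  · rintro _ ⟨l, k, hk, rfl⟩
    by_cases hl : l = j
    · subst hl
      rw [Function.update_self] at hk
      exact ⟨_, ⟨l, k + a, by omega, fun _ => Nat.le_add_left _ _, rfl⟩, hpre k⟩
    · rw [Function.update_of_ne hl] at hk
      exact ⟨_, ⟨l, k, hk, fun h => absurd h hl, rfl⟩, hpre' l k hl⟩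
  · rintro _ ⟨l, k, hk, hl, rfl⟩
    by_cases hlj : l = j
    · subst hlj
      have := hl rfl
      obtain ⟨m, rfl⟩ : ∃ m, k = m + a := ⟨k - a, by omega⟩
      rw [hpre]
      exact ⟨l, m, by rw [Function.update_self]; omega, rfl⟩
    · rw [hpre' l k hlj]
      exact ⟨l, k, by rwa [Function.update_of_ne hlj], rfl⟩

/-- The bounds on `a` say that line `j` has neither a window starting at `a` or later nor a vertex
there, so its tail is empty. -/
theorem nonempty_homology_equiv_remove (hφ : Function.Injective φ)
    (hr : ∀ p, p ∈ Set.range φ ↔ p.2 + 1 < s p.1 + t) {W : Type*} [Fintype W] [LinearOrder W]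
    {j : ι} {ψ : W → {k // k ≠ j} × ℕ} {a : ℕ} (ha : s j ≤ a) (ha' : s j + t ≤ a + 1)
    (hψ : Function.Injective ψ) (hr' : ∀ p, p ∈ Set.range ψ ↔ p.2 + 1 < s p.1 + t) (i : ℤ) :
    Nonempty (ReducedHomology K (missing φ (tailPoints j a) (tailWindows t s j a)) i ≃ₗ[K]
      ReducedHomology K
        (missing ψ Set.univ (windows t fun k : {k // k ≠ j} => s k)) i) := by
  have hpre : ∀ (l : {k // k ≠ j}) (k : ℕ),
      (fun p : {k // k ≠ j} × ℕ => ((p.1 : ι), p.2)) ⁻¹' window t (l : ι) k = window t l k := by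
    intro l k
    ext ⟨x, m⟩
    rw [Set.mem_preimage, mem_window, mem_window, Subtype.ext_iff]
  refine nonempty_homology_equiv_of_relabel K hφ hψ (θ := fun p => (p.1, p.2)) ?_ ?_ ?_ ?_ i
  · rintro ⟨x, m⟩ ⟨y, n⟩ h
    obtain ⟨h1, h2⟩ := Prod.mk.inj h
    exact Prod.ext (Subtype.ext h1) h2
  · rintro ⟨x, m⟩
    rw [hr]
    constructor
    · rintro ⟨h1, h2⟩
      have hx : x ≠ j := by
        rintro rfl
        have h2 : a ≤ m := h2 rfl
        simp only at h1
        omega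
      obtain ⟨w, hw⟩ := (hr' (⟨x, hx⟩, m)).2 h1
      exact ⟨w, by rw [hw]⟩
    · rintro ⟨w, hw⟩
      have h3 := (hr' _).1 ⟨w, rfl⟩
      generalize ψ w = p at hw h3
      obtain ⟨⟨y, hy⟩, n⟩ := p
      obtain ⟨rfl, rfl⟩ := Prod.mk.inj hw
      exact ⟨h3, fun h => absurd h hy⟩
  · rintro _ ⟨l, k, hk, rfl⟩
    exact ⟨_, ⟨l, k, hk, fun h => absurd h l.2, rfl⟩, hpre l k⟩
  · rintro _ ⟨l, k, hk, hl, rfl⟩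
    have hlj : l ≠ j := by
      rintro rfl
      have := hl rfl
      omega
    exact ⟨⟨l, hlj⟩, k, hk, hpre ⟨l, hlj⟩ k⟩

end Tail

end RunHomology

/-! ### Assembly of the four statements. -/

open RunHomology SComplex in
theorem mainTheorem7 {K : Type*} [Field K] (t r : ℕ) (ht : 2 ≤ t)
    {V : Type*} [Fintype V] [LinearOrder V] (Γ : SComplex V) (s : Fin r → ℕ)
    (hΓ : ComponentsAreRuns t Γ s) (j : Fin r) :
    (t + 2 ≤ s j →
      ∀ {V' : Type*} [Fintype V'] [LinearOrder V'] (Γ' : SComplex V'),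
        ComponentsAreRuns t Γ' (Function.update s j (s j - (t + 1))) →
        ∀ i : ℤ, Nonempty
          (ReducedHomology K Γ.compl i ≃ₗ[K] ReducedHomology K Γ'.compl (i - 2))) ∧
    (s j % (t + 1) ≠ 1 → s j % (t + 1) ≠ 2 →
      ∀ i : ℤ, Subsingleton (ReducedHomology K Γ.compl i)) ∧
    (s j = 2 → 2 ≤ r →
      ∀ {V' : Type*} [Fintype V'] [LinearOrder V'] (Γ' : SComplex V'),
        ComponentsAreRuns t Γ' (fun k : {k : Fin r // k ≠ j} => s k) →
        ∀ i : ℤ, Nonempty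
          (ReducedHomology K Γ.compl i ≃ₗ[K] ReducedHomology K Γ'.compl (i - 2))) ∧
    (s j = 1 → 2 ≤ r →
      ∀ {V' : Type*} [Fintype V'] [LinearOrder V'] (Γ' : SComplex V'),
        ComponentsAreRuns t Γ' (fun k : {k : Fin r // k ≠ j} => s k) →
        ∀ i : ℤ, Nonempty
          (ReducedHomology K Γ.compl i ≃ₗ[K] ReducedHomology K Γ'.compl (i - 1))) := by
  have : Nonempty (Fin r) := ⟨j⟩
  obtain ⟨φ, hφ, hr, hc⟩ := hΓ.exists_compl_eq_missing ht
  have other : 2 ≤ r → ∃ l, l ≠ j := by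
    intro h
    have : Nontrivial (Fin r) := Fin.nontrivial_iff_two_le.2 h
    exact exists_ne j
  refine ⟨fun hs V' _ _ Γ' hΓ' i => ?_, fun h1 h2 i => ?_, fun hs h2 V' _ _ Γ' hΓ' i => ?_,
    fun hs h2 V' _ _ Γ' hΓ' i => ?_⟩
  · obtain ⟨ψ, hψ, hr', hc'⟩ := hΓ'.exists_compl_eq_missing ht
    obtain ⟨i, rfl⟩ : ∃ k, i = k + 1 + 1 := ⟨i - 1 - 1, by ring⟩
    obtain ⟨e₁⟩ := nonempty_homology_equiv_tail K ht hφ hr (j := j) (a := 0) (by omega)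
      ⟨_, j, 0 + t + 1, by omega, fun _ => le_rfl, rfl⟩ i
    obtain ⟨e₂⟩ := nonempty_homology_equiv_shorten K hφ hr (by omega) hψ hr' i
    rw [hc, hc', show i + 1 + 1 - 2 = i by ring]
    rw [tailPoints_zero, tailWindows_zero, zero_add] at e₁
    exact ⟨e₁.trans e₂⟩
  · rw [hc, ← tailPoints_zero j, ← tailWindows_zero t s j]
    exact subsingleton_homology_tail K ht hφ hr (s j) 0 (by omega)
      -- Positivity of `s j` matters here, because 0 has an allowed residue.
      (by have := hΓ.1 j; omega) h1 h2 i
  · obtain ⟨l, hl⟩ := other h2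
    have : Nonempty {k : Fin r // k ≠ j} := ⟨⟨l, hl⟩⟩
    obtain ⟨ψ, hψ, hr', hc'⟩ := hΓ'.exists_compl_eq_missing ht
    obtain ⟨i, rfl⟩ : ∃ k, i = k + 1 + 1 := ⟨i - 1 - 1, by ring⟩
    obtain ⟨e₁⟩ := nonempty_homology_equiv_tail K ht hφ hr (j := j) (a := 0) (by omega)
      ⟨_, l, 0, hΓ.1 l, fun h => absurd h hl, rfl⟩ i
    -- A run of length 2 has exactly `t + 1` vertices, so one shortening uses up the line.
    obtain ⟨e₂⟩ := nonempty_homology_equiv_remove K hφ hr (a := t + 1) (by omega) (by omega)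
      hψ hr' i
    rw [hc, hc', show i + 1 + 1 - 2 = i by ring]
    rw [tailPoints_zero, tailWindows_zero, zero_add] at e₁
    exact ⟨e₁.trans e₂⟩
  · obtain ⟨l, hl⟩ := other h2
    have : Nonempty {k : Fin r // k ≠ j} := ⟨⟨l, hl⟩⟩
    obtain ⟨ψ, hψ, hr', hc'⟩ := hΓ'.exists_compl_eq_missing ht
    obtain ⟨i, rfl⟩ : ∃ k, i = k + 1 := ⟨i - 1, by ring⟩
    obtain ⟨e₁⟩ := nonempty_homology_equiv_of_single K (φ := φ) ht hr hs
      ⟨_, l, 0, hΓ.1 l, fun h => absurd h hl, rfl⟩ i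
    obtain ⟨e₂⟩ := nonempty_homology_equiv_remove K hφ hr (a := t) (by omega) (by omega)
      hψ hr' i
    rw [hc, hc', show i + 1 - 1 = i by ring]
    exact ⟨e₁.trans e₂⟩
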